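/- Let $n\ge 1$, $0<\alpha<2$, let $C_{n,\alpha}>0$ be a constant, and let $G\in C^1(\mathbb{R})$ satisfy $G(0)=0$ and $G'(t)\ge c_0>0$ for all $t\in\mathbb{R}$. For $u:\mathbb{R}^n\to\mathbb{R}$ put $$F_\alpha(u)(x)=C_{n,\alpha}\lim_{\epsilon\to0^+}\int_{\mathbb{R}^n\setminus B_\epsilon(x)}\frac{G(u(x)-u(z))}{|x-z|^{n+\alpha}}\,dz .$$ Let $L_\alpha=\{u\in L^1_{loc}(\mathbb{R}^n) : \int_{\mathbb{R}^n}\frac{|u(x)|}{1+|x|^{n+\alpha}}\,dx<\infty\}$, and let $C^{1,1}_{loc}(\mathbb{R}^n)$ be the set of differentiable functions with locally Lipschitz gradient. Let $g$ be a real function that is differentiable on $(0,\infty)$, and let $u\in C^{1,1}_{loc}(\mathbb{R}^n)\cap L_\alpha$ be a positive solution of $$F_\alpha(u)(x)=g(u(x)),\qquad x\in\mathbb{R}^n,$$ that is, $u(x)>0$, the limit defining $F_\alpha(u)(x)$ exists, and the equation holds for every $x\in\mathbb{R}^n$. Suppose that for some $\gamma>0$ and some $q\in\mathbb{R}$ with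 $q\gamma\ge\alpha$, $$u(x)=o\Big(\frac1{|x|^{\gamma}}\Big)\ \text{ as } |x|\to\infty,\qquad g'(s)\le s^q\ \text{ for all } s>0 .$$ Then $u$ is radially symmetric about some point $x_0\in\mathbb{R}^n$, i.e. $u(x)$ depends only on $|x-x_0|$. -/

import Mathlib

open Filter Topology MeasureTheory Asymptotics

namespace FullyNonlinear

/-- The class `C^{1,1}_loc(ℝⁿ)`: differentiable functions whose derivative is locally Lipschitz. -/
def IsC11Loc {n : ℕ} (u : EuclideanSpace ℝ (Fin n) → ℝ) : Prop :=
  Differentiable ℝ u ∧ LocallyLipschitz (fderiv ℝ u)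

/-- The space `L_α`: locally integrable `u` with `∫ |u(x)| / (1 + |x|^{n+α}) dx < ∞`. -/
def MemLAlpha {n : ℕ} (α : ℝ) (u : EuclideanSpace ℝ (Fin n) → ℝ) : Prop :=
  LocallyIntegrable u volume ∧
    Integrable (fun x => |u x| / (1 + ‖x‖ ^ ((n : ℝ) + α))) volume

/-- `HasFAlpha C α G u x v` says that `F_α(u)` is defined at the point `x` and equals `v`, where
`F_α(u)(x) = C · lim_{ε → 0+} ∫_{ℝⁿ ∖ B_ε(x)} G(u(x) - u(z)) / |x - z|^{n+α} dz`:
the truncated integrals converge absolutely, and their limit, times `C`, is `v`. -/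
def HasFAlpha {n : ℕ} (C α : ℝ) (G : ℝ → ℝ) (u : EuclideanSpace ℝ (Fin n) → ℝ)
    (x : EuclideanSpace ℝ (Fin n)) (v : ℝ) : Prop :=
  (∀ ε : ℝ, 0 < ε → IntegrableOn (fun z => G (u x - u z) / ‖x - z‖ ^ ((n : ℝ) + α))
      (Metric.ball x ε)ᶜ volume) ∧
    Tendsto (fun ε : ℝ =>
        C * ∫ z in (Metric.ball x ε)ᶜ, G (u x - u z) / ‖x - z‖ ^ ((n : ℝ) + α))
      (𝓝[>] 0) (𝓝 v)

/-- `u` is radially symmetric about the point `x₀`: its value at `x` depends only on `|x - x₀|`. -/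
def IsRadialAbout {n : ℕ} (u : EuclideanSpace ℝ (Fin n) → ℝ)
    (x₀ : EuclideanSpace ℝ (Fin n)) : Prop :=
  ∀ x y, ‖x - x₀‖ = ‖y - x₀‖ → u x = u y

end FullyNonlinear

/-! The proof is the method of moving planes. For a unit vector `e` and the reflection `R` in the
hyperplane `⟪e, x⟫ = l`, put `w = u ∘ R - u` on the half-space below it. Pairing the integrand of
`F_α(u ∘ R)(x) - F_α(u)(x)` at `z` and `R z`, and using `G' ≥ c₀`, shows that at a negative minimum
of `w` this difference is at most `K * d ^ (-α) * w x`, with `d` the distance to the hyperplane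
(`sub_le_reflectionDefect`).

By the equation it equals `g (u (R x)) - g (u x)`, so the mean value theorem and `g' s ≤ s ^ q` give
`K ≤ u x ^ q * d ^ α` (`exists_pos_le_rpow_mul_rpow`). Since `q * γ ≥ α`, the decay of `u` keeps
negative minima in a bounded set, and the same bound keeps them away from the hyperplane. Hence the
plane can move up from `-∞` until `w` vanishes at an interior point, where the strong maximum
principle (`reflectionDefect_eq_zero_of_inner_lt`) makes `w` vanish identically. Symmetry in every
direction, with positivity and decay, forces all the hyperplanes through one point. -/

namespace FullyNonlinear

section

/-! ### Reflections in hyperplanes. -/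

section Reflection

variable {V : Type*} [NormedAddCommGroup V] [InnerProductSpace ℝ V]

/-- Reflection across the hyperplane `{x | ⟪e, x⟫ = l}`, for a unit vector `e`. -/
def planeReflection (e : V) (l : ℝ) (x : V) : V := x + (2 * (l - inner ℝ e x)) • e

variable {e : V} {l : ℝ}

theorem inner_planeReflection (he : ‖e‖ = 1) (x : V) :
    inner ℝ e (planeReflection e l x) = 2 * l - inner ℝ e x := by
  simp only [planeReflection, inner_add_right, inner_smul_right, real_inner_self_eq_norm_sq, he]
  ring

theorem planeReflection_involutive (he : ‖e‖ = 1) :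
    Function.Involutive (planeReflection e l) := by
  intro x
  rw [planeReflection, inner_planeReflection he, planeReflection, add_assoc, ← add_smul,
    show 2 * (l - inner ℝ e x) + 2 * (l - (2 * l - inner ℝ e x)) = 0 by ring, zero_smul, add_zero]

/-- The correction term is positive exactly when `x` and `z` lie strictly on the same side, so there
reflecting `z` decreases the kernel. -/
theorem norm_sub_planeReflection_sq (he : ‖e‖ = 1) (x z : V) :
    ‖x - planeReflection e l z‖ ^ 2
      = ‖x - z‖ ^ 2 + 4 * (l - inner ℝ e x) * (l - inner ℝ e z) := by
  rw [planeReflection, ← sub_sub, norm_sub_sq_real, inner_smul_right, norm_smul, he,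
    real_inner_comm e (x - z), inner_sub_right, mul_one, Real.norm_eq_abs, sq_abs]
  ring

theorem isometry_planeReflection (he : ‖e‖ = 1) : Isometry (planeReflection e l) := by
  refine Isometry.of_dist_eq fun x z => ?_
  rw [dist_eq_norm, dist_eq_norm, ← sq_eq_sq₀ (norm_nonneg _) (norm_nonneg _),
    norm_sub_planeReflection_sq he, norm_sub_rev, norm_sub_planeReflection_sq he,
    inner_planeReflection he, norm_sub_rev]
  ring

theorem norm_planeReflection_sub_planeReflection (he : ‖e‖ = 1) (x z : V) :
    ‖planeReflection e l x - planeReflection e l z‖ = ‖x - z‖ := by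
  rw [← dist_eq_norm, (isometry_planeReflection he).dist_eq, dist_eq_norm]

theorem norm_planeReflection_sub (he : ‖e‖ = 1) (x z : V) :
    ‖planeReflection e l x - z‖ = ‖x - planeReflection e l z‖ := by
  conv_lhs => rw [← planeReflection_involutive he (l := l) z]
  rw [norm_planeReflection_sub_planeReflection he]

theorem continuous_planeReflection_uncurry (e : V) :
    Continuous fun p : ℝ × V => planeReflection e p.1 p.2 := by
  unfold planeReflection
  fun_prop

theorem norm_sub_planeReflection_self (he : ‖e‖ = 1) (x : V) :
    ‖x - planeReflection e l x‖ = 2 * |l - inner ℝ e x| := by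
  rw [planeReflection, sub_add_cancel_left, norm_neg, norm_smul, he]
  simp

theorem measurePreserving_planeReflection [MeasurableSpace V] [BorelSpace V]
    [FiniteDimensional ℝ V] (he : ‖e‖ = 1) :
    MeasurePreserving (planeReflection e l) (volume : Measure V) volume := by
  have h := (measurePreserving_add_right (volume : Measure V) ((2 * l) • e)).comp
    (LinearIsometryEquiv.measurePreserving (ℝ ∙ e)ᗮ.reflection)
  have heq : planeReflection e l = (fun x => x + (2 * l) • e) ∘ (ℝ ∙ e)ᗮ.reflection := by
    ext x
    rw [Function.comp_apply, Submodule.reflection_orthogonal_apply,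
      Submodule.reflection_singleton_apply, he, planeReflection]
    simp only [RCLike.ofReal_real_eq_id, id, one_pow, div_one]
    module
  rwa [heq]

theorem measurableEmbedding_planeReflection [MeasurableSpace V] [BorelSpace V]
    [FiniteDimensional ℝ V] (he : ‖e‖ = 1) :
    MeasurableEmbedding (planeReflection e l) :=
  (isometry_planeReflection he).isClosedEmbedding.measurableEmbedding

end Reflection

/-! ### Principal values under reflection. -/

variable {n : ℕ}

theorem tendsto_volume_ball_zero (hn : 1 ≤ n) (y : EuclideanSpace ℝ (Fin n)) :
    Tendsto (fun ε : ℝ => volume (Metric.ball y ε)) (𝓝[>] 0) (𝓝 0) := by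
  have h1 : Tendsto (fun ε : ℝ => ENNReal.ofReal (ε ^ n)
      * volume (Metric.ball (0 : EuclideanSpace ℝ (Fin n)) 1)) (𝓝[>] 0) (𝓝 0) := by
    have h2 : Tendsto (fun ε : ℝ => ε ^ n) (𝓝[>] 0) (𝓝 0) := by
      have : Tendsto (fun ε : ℝ => ε ^ n) (𝓝 0) (𝓝 (0 ^ n)) := (continuous_pow n).tendsto 0
      rw [zero_pow (by omega)] at this
      exact this.mono_left nhdsWithin_le_nhds
    have h3 := ENNReal.Tendsto.mul_const (ENNReal.tendsto_ofReal h2)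
      (b := volume (Metric.ball (0 : EuclideanSpace ℝ (Fin n)) 1))
      (Or.inr measure_ball_lt_top.ne)
    simpa using h3
  refine h1.congr' ?_
  filter_upwards [self_mem_nhdsWithin] with ε hε
  rw [Measure.addHaar_ball_of_pos _ _ hε, finrank_euclideanSpace_fin]

/-- The integrand of `F_α(u ∘ R)(x) - F_α(u)(x)`, with `R` the reflection across
`{z | ⟪e, z⟫ = l}` and `κ = n + α`. -/
noncomputable def reflectedDifference (G : ℝ → ℝ) (u : EuclideanSpace ℝ (Fin n) → ℝ)
    (e : EuclideanSpace ℝ (Fin n)) (l κ : ℝ) (x z : EuclideanSpace ℝ (Fin n)) : ℝ :=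
  (G (u (planeReflection e l x) - u (planeReflection e l z)) - G (u x - u z)) / ‖x - z‖ ^ κ

/-- The sum of `reflectedDifference` at `z` and at the reflection of `z`. -/
noncomputable def symmetrizedDifference (G : ℝ → ℝ) (u : EuclideanSpace ℝ (Fin n) → ℝ)
    (e : EuclideanSpace ℝ (Fin n)) (l κ : ℝ) (x z : EuclideanSpace ℝ (Fin n)) : ℝ :=
  reflectedDifference G u e l κ x z + reflectedDifference G u e l κ x (planeReflection e l z)

variable {G : ℝ → ℝ} {u : EuclideanSpace ℝ (Fin n) → ℝ} {e x : EuclideanSpace ℝ (Fin n)}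
  {l α C v v' : ℝ}

theorem symmetrizedDifference_planeReflection (he : ‖e‖ = 1) (κ : ℝ)
    (z : EuclideanSpace ℝ (Fin n)) :
    symmetrizedDifference G u e l κ x (planeReflection e l z)
      = symmetrizedDifference G u e l κ x z := by
  rw [symmetrizedDifference, planeReflection_involutive he, add_comm, symmetrizedDifference]

theorem HasFAlpha.comp_planeReflection (he : ‖e‖ = 1)
    (h : HasFAlpha C α G u (planeReflection e l x) v) :
    HasFAlpha C α G (u ∘ planeReflection e l) x v := by
  have hpre : ∀ ε : ℝ, planeReflection e l ⁻¹' (Metric.ball (planeReflection e l x) ε)ᶜ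
      = (Metric.ball x ε)ᶜ := by
    intro ε
    ext z
    simp [(isometry_planeReflection he).dist_eq]
  have hf : ∀ z, G (u (planeReflection e l x) - u (planeReflection e l z))
      / ‖planeReflection e l x - planeReflection e l z‖ ^ ((n : ℝ) + α)
      = G ((u ∘ planeReflection e l) x - (u ∘ planeReflection e l) z)
        / ‖x - z‖ ^ ((n : ℝ) + α) := by
    intro z
    rw [norm_planeReflection_sub_planeReflection he]
    rfl
  refine ⟨fun ε hε => ?_, ?_⟩
  · have := ((measurePreserving_planeReflection (l := l) he).integrableOn_comp_preimage
      (measurableEmbedding_planeReflection he)).2 (h.1 ε hε)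
    rw [hpre] at this
    exact this.congr_fun (fun z _ => hf z) (measurableSet_ball.compl)
  · refine h.2.congr fun ε => ?_
    rw [← (measurePreserving_planeReflection (l := l) he).setIntegral_preimage_emb
      (measurableEmbedding_planeReflection he), hpre]
    simp only [hf]

theorem integrableOn_reflectedDifference (he : ‖e‖ = 1) (h : HasFAlpha C α G u x v)
    (h' : HasFAlpha C α G u (planeReflection e l x) v') {ε : ℝ} (hε : 0 < ε) :
    IntegrableOn (reflectedDifference G u e l (n + α) x) (Metric.ball x ε)ᶜ volume := by
  have := ((h'.comp_planeReflection he).1 ε hε).sub (h.1 ε hε)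
  refine this.congr_fun (fun z _ => ?_) measurableSet_ball.compl
  simp [reflectedDifference, sub_div]

/-- The complement of the `ε`-balls around `x` and around its reflection. -/
def puncturedSpace (e : EuclideanSpace ℝ (Fin n)) (l : ℝ) (x : EuclideanSpace ℝ (Fin n))
    (ε : ℝ) : Set (EuclideanSpace ℝ (Fin n)) :=
  (Metric.ball x ε ∪ Metric.ball (planeReflection e l x) ε)ᶜ

theorem measurableSet_puncturedSpace (ε : ℝ) : MeasurableSet (puncturedSpace e l x ε) :=
  (measurableSet_ball.union measurableSet_ball).compl

theorem preimage_puncturedSpace (he : ‖e‖ = 1) (ε : ℝ) :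
    planeReflection e l ⁻¹' puncturedSpace e l x ε = puncturedSpace e l x ε := by
  ext z
  simp only [puncturedSpace, Set.mem_preimage, Set.mem_compl_iff, Set.mem_union, Metric.mem_ball,
    dist_eq_norm, norm_planeReflection_sub_planeReflection he, norm_planeReflection_sub he]
  tauto

theorem integrableOn_puncturedSpace (he : ‖e‖ = 1) (h : HasFAlpha C α G u x v)
    (h' : HasFAlpha C α G u (planeReflection e l x) v') {ε : ℝ} (hε : 0 < ε) :
    IntegrableOn (reflectedDifference G u e l (n + α) x) (puncturedSpace e l x ε) volume :=
  (integrableOn_reflectedDifference he h h' hε).mono_set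
    (Set.compl_subset_compl.2 Set.subset_union_left)

/-- The integrand is singular only at `x`, so removing a shrinking ball around the reflected point
does not affect the limit. It makes the domain invariant under the reflection. -/
theorem tendsto_integral_puncturedSpace (hn : 1 ≤ n) (he : ‖e‖ = 1) (h : HasFAlpha C α G u x v)
    (h' : HasFAlpha C α G u (planeReflection e l x) v') (hx : planeReflection e l x ≠ x) :
    Tendsto (fun ε : ℝ => C * ∫ z in puncturedSpace e l x ε,
      reflectedDifference G u e l (n + α) x z) (𝓝[>] 0) (𝓝 (v' - v)) := by
  set P := reflectedDifference G u e l (n + α) x with hP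
  have hlim : Tendsto (fun ε : ℝ => C * ∫ z in (Metric.ball x ε)ᶜ, P z) (𝓝[>] 0)
      (𝓝 (v' - v)) := by
    refine ((h'.comp_planeReflection he).2.sub h.2).congr' ?_
    filter_upwards [self_mem_nhdsWithin] with ε hε
    rw [← mul_sub, ← integral_sub ((h'.comp_planeReflection he).1 ε hε) (h.1 ε hε)]
    simp [hP, reflectedDifference, sub_div]
  set ρ := dist (planeReflection e l x) x / 2 with hρ
  have hρ0 : 0 < ρ := half_pos (dist_pos.2 hx)
  have hsub : ∀ ε ≤ ρ, ∀ z ∈ Metric.ball (planeReflection e l x) ε, z ∉ Metric.ball x ε := by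
    intro ε hε z hz hz'
    rw [Metric.mem_ball] at hz hz'
    have := dist_triangle_left (planeReflection e l x) x z
    linarith
  have hsmall : Tendsto (fun ε : ℝ => ∫ z in Metric.ball (planeReflection e l x) ε,
      (Metric.ball x ρ)ᶜ.indicator P z) (𝓝[>] 0) (𝓝 0) :=
    Integrable.tendsto_setIntegral_nhds_zero
      ((integrable_indicator_iff measurableSet_ball.compl).2
        (integrableOn_reflectedDifference he h h' hρ0))
      (tendsto_volume_ball_zero hn _)
  have := hlim.sub (hsmall.const_mul C)
  rw [mul_zero, sub_zero] at this
  refine this.congr' ?_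
  filter_upwards [self_mem_nhdsWithin, nhdsWithin_le_nhds (Iio_mem_nhds hρ0)] with ε hε hερ
  have hερ : ε ≤ ρ := le_of_lt hερ
  have e1 : ∫ z in Metric.ball (planeReflection e l x) ε, (Metric.ball x ρ)ᶜ.indicator P z
      = ∫ z in Metric.ball (planeReflection e l x) ε, P z := by
    refine setIntegral_congr_fun measurableSet_ball fun z hz => ?_
    exact Set.indicator_of_mem
      (hsub ρ le_rfl z (Metric.ball_subset_ball hερ hz)) _
  have e2 : (Metric.ball x ε)ᶜ
      = puncturedSpace e l x ε ∪ Metric.ball (planeReflection e l x) ε := by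
    ext z
    have := hsub ε hερ z
    simp only [puncturedSpace, Set.mem_compl_iff, Set.mem_union]
    tauto
  have hint := integrableOn_reflectedDifference he h h' hε
  rw [e1, ← mul_sub, e2, setIntegral_union _ measurableSet_ball
    (integrableOn_puncturedSpace he h h' hε), add_sub_cancel_right]
  · refine hint.mono_set ?_
    rw [e2]
    exact Set.subset_union_right
  · rw [Set.disjoint_left]
    intro z hz hz'
    exact hz (Or.inr hz')

theorem integral_symmetrizedDifference (he : ‖e‖ = 1) (h : HasFAlpha C α G u x v)
    (h' : HasFAlpha C α G u (planeReflection e l x) v') {ε : ℝ} (hε : 0 < ε) :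
    IntegrableOn (symmetrizedDifference G u e l (n + α) x) (puncturedSpace e l x ε) volume ∧
    ∫ z in puncturedSpace e l x ε, symmetrizedDifference G u e l (n + α) x z
      = 2 * ∫ z in puncturedSpace e l x ε, reflectedDifference G u e l (n + α) x z := by
  have h1 := integrableOn_puncturedSpace he h h' hε
  have h2 := ((measurePreserving_planeReflection (l := l) he).integrableOn_comp_preimage
    (measurableEmbedding_planeReflection he)).2 h1
  have h3 := (measurePreserving_planeReflection (l := l) he).setIntegral_preimage_emb
    (measurableEmbedding_planeReflection he) (reflectedDifference G u e l (n + α) x)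
    (puncturedSpace e l x ε)
  rw [preimage_puncturedSpace he] at h2 h3
  refine ⟨h1.add h2, ?_⟩
  have := integral_add h1 h2
  simp only [Function.comp] at this
  simp only [symmetrizedDifference]
  rw [this, h3, two_mul]

/-- The nonpositive integrand may be discarded outside `ball y r`, which avoids both removed balls
once `ε < r`. The factor `1 / 2` undoes the symmetrization. -/
theorem sub_le_of_symmetrizedDifference_le (hn : 1 ≤ n) (he : ‖e‖ = 1) (hC : 0 < C)
    (h : HasFAlpha C α G u x v)
    (h' : HasFAlpha C α G u (planeReflection e l x) v') (hx : planeReflection e l x ≠ x)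
    (hneg : ∀ z, z ≠ x → z ≠ planeReflection e l x →
      symmetrizedDifference G u e l (n + α) x z ≤ 0)
    {y : EuclideanSpace ℝ (Fin n)} {r m : ℝ} (hr : 0 < r) (hy : 2 * r ≤ dist y x)
    (hy' : 2 * r ≤ dist y (planeReflection e l x))
    (hm : ∀ z ∈ Metric.ball y r, symmetrizedDifference G u e l (n + α) x z ≤ -m) :
    v' - v ≤ -(C * m * volume.real (Metric.ball y r) / 2) := by
  refine le_of_tendsto (tendsto_integral_puncturedSpace hn he h h' hx) ?_
  filter_upwards [self_mem_nhdsWithin, nhdsWithin_le_nhds (Iio_mem_nhds hr)] with ε hε hεr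
  have hε : 0 < ε := hε
  have hεr : ε < r := hεr
  obtain ⟨hi, heq⟩ := integral_symmetrizedDifference he h h' hε
  have hsub : Metric.ball y r ⊆ puncturedSpace e l x ε := by
    intro z hz hz'
    rw [Metric.mem_ball] at hz
    rcases hz' with hz' | hz' <;> rw [Metric.mem_ball] at hz'
    · linarith [dist_triangle_left y x z]
    · linarith [dist_triangle_left y (planeReflection e l x) z]
  have h1 : ∫ z in puncturedSpace e l x ε, symmetrizedDifference G u e l (n + α) x z
      ≤ ∫ z in Metric.ball y r, symmetrizedDifference G u e l (n + α) x z := by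
    have := setIntegral_mono_set (f := fun z => -symmetrizedDifference G u e l (n + α) x z)
      hi.neg ?_ (LE.le.eventuallyLE hsub)
    · rw [integral_neg, integral_neg] at this
      linarith
    · refine (ae_restrict_iff' (measurableSet_puncturedSpace ε)).2 (ae_of_all _ fun z hz => ?_)
      have hz1 : z ≠ x := by
        rintro rfl
        exact hz (Or.inl (Metric.mem_ball_self hε))
      have hz2 : z ≠ planeReflection e l x := by
        rintro rfl
        exact hz (Or.inr (Metric.mem_ball_self hε))
      simpa using hneg z hz1 hz2
  have h2 : ∫ z in Metric.ball y r, symmetrizedDifference G u e l (n + α) x z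
      ≤ ∫ _ in Metric.ball y r, -m :=
    setIntegral_mono_on (hi.mono_set hsub)
      (integrableOn_const measure_ball_lt_top.ne) measurableSet_ball hm
  rw [setIntegral_const, smul_eq_mul] at h2
  nlinarith

end

/-! ### Maximum principles for the antisymmetric defect. -/

section

/-- The pointwise inequality behind the maximum principle for antisymmetric functions: here `a`, `b`
are the values of the reflected and the original function at a minimum of their difference, `p`, `r`
the values at another point, and `k₁ ≥ k₂` the kernel before and after reflection. -/
theorem antisymmetric_kernel_le {G : ℝ → ℝ} {c₀ : ℝ}
    (hG : ∀ s t : ℝ, s ≤ t → c₀ * (t - s) ≤ G t - G s)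
    {a b p r k₁ k₂ : ℝ} (hab : a ≤ b) (hmin : a - b ≤ p - r) (hk₂ : 0 ≤ k₂) (hk : k₂ ≤ k₁) :
    (G (a - p) - G (b - r)) * k₁ + (G (a - r) - G (b - p)) * k₂
      ≤ -((k₁ - k₂) * (c₀ * (p - r - (a - b)))) - 2 * (k₂ * (c₀ * (b - a))) := by
  -- Split `k₁ = (k₁ - k₂) + k₂` and regroup the `k₂` terms so that the arguments of `G` in each
  -- pair differ by `a - b`.
  have h1 := mul_le_mul_of_nonneg_left (hG (a - p) (b - r) (by linarith)) (sub_nonneg.2 hk)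
  have h2 := mul_le_mul_of_nonneg_left (hG (a - p) (b - p) (by linarith)) hk₂
  have h3 := mul_le_mul_of_nonneg_left (hG (a - r) (b - r) (by linarith)) hk₂
  linarith

variable {n : ℕ} {G g : ℝ → ℝ} {u : EuclideanSpace ℝ (Fin n) → ℝ}
  {e x : EuclideanSpace ℝ (Fin n)} {l α C c₀ κ : ℝ}

/-- The difference between the reflected function and the function. -/
noncomputable def reflectionDefect (u : EuclideanSpace ℝ (Fin n) → ℝ)
    (e : EuclideanSpace ℝ (Fin n)) (l : ℝ) (x : EuclideanSpace ℝ (Fin n)) : ℝ :=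
  u (planeReflection e l x) - u x

theorem reflectionDefect_planeReflection (he : ‖e‖ = 1) :
    reflectionDefect u e l (planeReflection e l x) = -reflectionDefect u e l x := by
  simp [reflectionDefect, planeReflection_involutive he x]

theorem reflectionDefect_of_inner_eq (hx : inner ℝ e x = l) : reflectionDefect u e l x = 0 := by
  simp [reflectionDefect, planeReflection, hx]

theorem continuous_reflectionDefect (hu : Continuous u) (e : EuclideanSpace ℝ (Fin n)) :
    Continuous fun p : ℝ × EuclideanSpace ℝ (Fin n) => reflectionDefect u e p.1 p.2 :=
  (hu.comp (continuous_planeReflection_uncurry e)).sub (hu.comp continuous_snd)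

theorem planeReflection_ne (he : ‖e‖ = 1) (hx : inner ℝ e x < l) :
    planeReflection e l x ≠ x := by
  intro h
  have := norm_sub_planeReflection_self (l := l) he x
  rw [h, sub_self, norm_zero, abs_of_pos (sub_pos.2 hx)] at this
  linarith

theorem inv_rpow_norm_sub_planeReflection_le (he : ‖e‖ = 1) (hκ : 0 < κ) (hx : inner ℝ e x < l)
    {z : EuclideanSpace ℝ (Fin n)} (hz : inner ℝ e z ≤ l) (hzx : z ≠ x) :
    (‖x - planeReflection e l z‖ ^ κ)⁻¹ ≤ (‖x - z‖ ^ κ)⁻¹ := by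
  have hle : ‖x - z‖ ≤ ‖x - planeReflection e l z‖ := by
    rw [← sq_le_sq₀ (norm_nonneg _) (norm_nonneg _), norm_sub_planeReflection_sq he]
    have := mul_nonneg (sub_nonneg.2 hx.le) (sub_nonneg.2 hz)
    linarith
  have hpos : 0 < ‖x - z‖ := norm_pos_iff.2 (sub_ne_zero.2 hzx.symm)
  exact inv_anti₀ (Real.rpow_pos_of_pos hpos _) (Real.rpow_le_rpow hpos.le hle hκ.le)

theorem reflectionDefect_le_of_inner_le (hneg : reflectionDefect u e l x ≤ 0)
    (hmin : ∀ z, inner ℝ e z < l → reflectionDefect u e l x ≤ reflectionDefect u e l z)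
    {z : EuclideanSpace ℝ (Fin n)} (hz : inner ℝ e z ≤ l) :
    reflectionDefect u e l x ≤ reflectionDefect u e l z := by
  rcases hz.lt_or_eq with h | h
  · exact hmin z h
  · rw [reflectionDefect_of_inner_eq h]
    exact hneg

theorem symmetrizedDifference_le (he : ‖e‖ = 1) (hκ : 0 < κ)
    (hG : ∀ s t : ℝ, s ≤ t → c₀ * (t - s) ≤ G t - G s)
    (hx : inner ℝ e x < l) (hneg : reflectionDefect u e l x ≤ 0)
    (hmin : ∀ z, inner ℝ e z < l → reflectionDefect u e l x ≤ reflectionDefect u e l z)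
    {z : EuclideanSpace ℝ (Fin n)} (hz : inner ℝ e z ≤ l) (hzx : z ≠ x) :
    symmetrizedDifference G u e l κ x z
      ≤ -(((‖x - z‖ ^ κ)⁻¹ - (‖x - planeReflection e l z‖ ^ κ)⁻¹)
          * (c₀ * (reflectionDefect u e l z - reflectionDefect u e l x)))
        + 2 * ((‖x - planeReflection e l z‖ ^ κ)⁻¹ * (c₀ * reflectionDefect u e l x)) := by
  have hk := inv_rpow_norm_sub_planeReflection_le he hκ hx hz hzx
  have hminz := reflectionDefect_le_of_inner_le hneg hmin hz
  have hab : u (planeReflection e l x) ≤ u x := by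
    simpa [reflectionDefect] using hneg
  have := antisymmetric_kernel_le hG hab hminz
    (inv_nonneg.2 (Real.rpow_nonneg (norm_nonneg (x - planeReflection e l z)) κ)) hk
  simp only [symmetrizedDifference, reflectedDifference, planeReflection_involutive he z,
    div_eq_mul_inv]
  refine this.trans (le_of_eq ?_)
  simp only [reflectionDefect]
  ring

theorem symmetrizedDifference_nonpos (he : ‖e‖ = 1) (hκ : 0 < κ) (hc₀ : 0 ≤ c₀)
    (hG : ∀ s t : ℝ, s ≤ t → c₀ * (t - s) ≤ G t - G s)
    (hx : inner ℝ e x < l) (hneg : reflectionDefect u e l x ≤ 0)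
    (hmin : ∀ z, inner ℝ e z < l → reflectionDefect u e l x ≤ reflectionDefect u e l z)
    (z : EuclideanSpace ℝ (Fin n)) (hzx : z ≠ x) (hzx' : z ≠ planeReflection e l x) :
    symmetrizedDifference G u e l κ x z ≤ 0 := by
  have key : ∀ z, inner ℝ e z ≤ l → z ≠ x → symmetrizedDifference G u e l κ x z ≤ 0 := by
    intro z hz hzx
    refine (symmetrizedDifference_le he hκ hG hx hneg hmin hz hzx).trans ?_
    have hk := inv_rpow_norm_sub_planeReflection_le he hκ hx hz hzx
    have hminz := reflectionDefect_le_of_inner_le hneg hmin hz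
    have h1 := mul_nonneg (sub_nonneg.2 hk) (mul_nonneg hc₀ (sub_nonneg.2 hminz))
    have h2 := mul_nonneg (inv_nonneg.2 (Real.rpow_nonneg
      (norm_nonneg (x - planeReflection e l z)) κ)) (mul_nonneg hc₀ (neg_nonneg.2 hneg))
    linarith
  rcases le_or_gt (inner ℝ e z) l with hz | hz
  · exact key z hz hzx
  · rw [← symmetrizedDifference_planeReflection he]
    refine key _ (by rw [inner_planeReflection he]; linarith) fun h => hzx' ?_
    rw [← h, planeReflection_involutive he]

/-- Quantitative maximum principle at a nonpositive minimum of the reflection defect. -/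
theorem sub_le_reflectionDefect (hn : 1 ≤ n) (he : ‖e‖ = 1) (hα : 0 < α) (hC : 0 < C)
    (hc₀ : 0 ≤ c₀) (hG : ∀ s t : ℝ, s ≤ t → c₀ * (t - s) ≤ G t - G s) {v v' : ℝ}
    (h : HasFAlpha C α G u x v) (h' : HasFAlpha C α G u (planeReflection e l x) v')
    (hx : inner ℝ e x < l) (hneg : reflectionDefect u e l x ≤ 0)
    (hmin : ∀ z, inner ℝ e z < l → reflectionDefect u e l x ≤ reflectionDefect u e l z) :
    v' - v ≤ C * c₀ * volume.real (Metric.ball (0 : EuclideanSpace ℝ (Fin n)) 1)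
      * ((5 : ℝ) ^ ((n : ℝ) + α))⁻¹ * ((l - inner ℝ e x) ^ α)⁻¹ * reflectionDefect u e l x := by
  have hκ : 0 < (n : ℝ) + α := by positivity
  set d := l - inner ℝ e x with hd
  have hd0 : 0 < d := sub_pos.2 hx
  have hRx : planeReflection e l x = x + (2 * d) • e := rfl
  have hvol : volume.real (Metric.ball (x + (4 * d) • e) d)
      = d ^ n * volume.real (Metric.ball (0 : EuclideanSpace ℝ (Fin n)) 1) := by
    rw [Measure.real, Measure.addHaar_ball_of_pos _ _ hd0, finrank_euclideanSpace_fin,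
      ENNReal.toReal_mul, ENNReal.toReal_ofReal (by positivity), Measure.real]
  -- The test ball lies beyond the hyperplane, its centre at distance `4 * d` from `x` and `2 * d`
  -- from the reflection of `x`; on it the distance to `x` is at most `5 * d`. Its volume, of order
  -- `d ^ n`, turns `d ^ (-(n + α))` into `d ^ (-α)`.
  have key := sub_le_of_symmetrizedDifference_le hn he hC h h' (planeReflection_ne he hx)
    (symmetrizedDifference_nonpos he hκ hc₀ hG hx hneg hmin) (y := x + (4 * d) • e) (r := d)
    (m := -(2 * (((5 * d) ^ ((n : ℝ) + α))⁻¹ * (c₀ * reflectionDefect u e l x)))) hd0 ?_ ?_ ?_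
  · refine key.trans (le_of_eq ?_)
    rw [hvol, Real.mul_rpow (by norm_num) hd0.le, Real.rpow_add hd0, Real.rpow_natCast]
    have h1 : d ^ n ≠ 0 := by positivity
    have h2 : d ^ α ≠ 0 := by positivity
    have h3 : (5 : ℝ) ^ ((n : ℝ) + α) ≠ 0 := by positivity
    field_simp
  · rw [dist_eq_norm, add_sub_cancel_left, norm_smul, he, Real.norm_of_nonneg (by positivity)]
    linarith
  · rw [dist_eq_norm, hRx, add_sub_add_left_eq_sub, ← sub_smul, norm_smul, he,
      Real.norm_of_nonneg (by linarith)]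
    linarith
  · intro z hz
    rw [Metric.mem_ball, dist_eq_norm] at hz
    have hin : |inner ℝ e (z - (x + (4 * d) • e))| < d := by
      refine (abs_real_inner_le_norm _ _).trans_lt ?_
      rwa [he, one_mul]
    rw [inner_sub_right, inner_add_right, inner_smul_right, real_inner_self_eq_norm_sq, he,
      abs_lt] at hin
    have hzin : l < inner ℝ e z := by
      linarith [hin.1]
    have hzle : ‖x - z‖ ≤ 5 * d := by
      have h1 : x - z = -(z - (x + (4 * d) • e)) - (4 * d) • e := by module
      rw [h1]
      refine (norm_sub_le _ _).trans ?_
      rw [norm_neg, norm_smul, he, Real.norm_of_nonneg (by positivity)]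
      linarith
    have hzx : z ≠ x := by
      rintro rfl
      linarith
    have hpos : 0 < ‖x - z‖ := norm_pos_iff.2 (sub_ne_zero.2 hzx.symm)
    have hRz : planeReflection e l z ≠ x := by
      rintro rfl
      rw [planeReflection_involutive he] at hRx
      have hh : inner ℝ e z = inner ℝ e (planeReflection e l z) + 2 * d := by
        rw [hRx, inner_add_right, inner_smul_right, real_inner_self_eq_norm_sq, he, ← hRx]
        ring
      have h2 : z - (planeReflection e l z + (4 * d) • e) = (-(2 * d)) • e := by
        nth_rewrite 1 [hRx]
        module
      rw [h2, norm_smul, he, norm_neg, Real.norm_of_nonneg (by positivity)] at hz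
      linarith
    have hRzin : inner ℝ e (planeReflection e l z) < l := by
      rw [inner_planeReflection he]
      linarith
    rw [← symmetrizedDifference_planeReflection he, neg_neg]
    refine (symmetrizedDifference_le he hκ hG hx hneg hmin hRzin.le hRz).trans ?_
    rw [planeReflection_involutive he]
    have hk := inv_rpow_norm_sub_planeReflection_le he hκ hx hRzin.le hRz
    rw [planeReflection_involutive he] at hk
    have h1 := mul_nonneg (sub_nonneg.2 hk)
      (mul_nonneg hc₀ (sub_nonneg.2 (hmin _ hRzin)))
    have hk' : ((5 * d) ^ ((n : ℝ) + α))⁻¹ ≤ (‖x - z‖ ^ ((n : ℝ) + α))⁻¹ :=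
      inv_anti₀ (Real.rpow_pos_of_pos hpos _) (Real.rpow_le_rpow hpos.le hzle hκ.le)
    have h2 := mul_nonneg (sub_nonneg.2 hk') (mul_nonneg hc₀ (neg_nonneg.2 hneg))
    linarith

/-- Strong maximum principle for the reflection defect. -/
theorem reflectionDefect_eq_zero_of_inner_lt (hn : 1 ≤ n) (he : ‖e‖ = 1) (hα : 0 < α)
    (hC : 0 < C) (hc₀ : 0 < c₀) (hGc : Continuous G) (hu : Continuous u)
    (hG : ∀ s t : ℝ, s ≤ t → c₀ * (t - s) ≤ G t - G s) {v : ℝ}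
    (h : HasFAlpha C α G u x v) (h' : HasFAlpha C α G u (planeReflection e l x) v)
    (hx : inner ℝ e x < l) (hx0 : reflectionDefect u e l x = 0)
    (hnonneg : ∀ z, inner ℝ e z < l → 0 ≤ reflectionDefect u e l z)
    {y : EuclideanSpace ℝ (Fin n)} (hy : inner ℝ e y < l) : reflectionDefect u e l y = 0 := by
  by_contra hne
  have hypos : 0 < reflectionDefect u e l y := lt_of_le_of_ne (hnonneg y hy) (Ne.symm hne)
  have hκ : 0 < (n : ℝ) + α := by positivity
  have hmin : ∀ z, inner ℝ e z < l → reflectionDefect u e l x ≤ reflectionDefect u e l z := by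
    rw [hx0]
    exact hnonneg
  have hyx : y ≠ x := by
    rintro rfl
    exact hne hx0
  have hyx' : y ≠ planeReflection e l x := by
    intro hyR
    rw [hyR, inner_planeReflection he] at hy
    linarith
  have hpos : 0 < ‖x - y‖ := norm_pos_iff.2 (sub_ne_zero.2 hyx.symm)
  have hlt : ‖x - y‖ < ‖x - planeReflection e l y‖ := by
    rw [← sq_lt_sq₀ (norm_nonneg _) (norm_nonneg _), norm_sub_planeReflection_sq he]
    have := mul_pos (sub_pos.2 hx) (sub_pos.2 hy)
    linarith
  have hk : (‖x - planeReflection e l y‖ ^ ((n : ℝ) + α))⁻¹ < (‖x - y‖ ^ ((n : ℝ) + α))⁻¹ :=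
    inv_strictAnti₀ (Real.rpow_pos_of_pos hpos _) (Real.rpow_lt_rpow hpos.le hlt hκ)
  -- Strictness comes from the strict kernel inequality and the positive defect at `y`. By
  -- continuity it persists on a ball, contradicting the common value `v` in `h` and `h'`.
  have hQy : symmetrizedDifference G u e l (n + α) x y < 0 := by
    refine (symmetrizedDifference_le he hκ hG hx hx0.le hmin hy.le hyx).trans_lt ?_
    rw [hx0]
    have := mul_pos (sub_pos.2 hk) (mul_pos hc₀ hypos)
    simp only [sub_zero, mul_zero, add_zero]
    linarith
  have hR : Continuous (planeReflection e l) := (isometry_planeReflection he).continuous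
  have hP : ∀ z, x ≠ z → ContinuousAt (reflectedDifference G u e l (n + α) x) z := by
    intro z hz
    have hz0 : ‖x - z‖ ≠ 0 := norm_ne_zero_iff.2 (sub_ne_zero.2 hz)
    refine ContinuousAt.div ?_ ?_ (Real.rpow_pos_of_pos (norm_pos_iff.2 (sub_ne_zero.2 hz)) _).ne'
    · exact Continuous.continuousAt (by fun_prop)
    · exact ContinuousAt.rpow_const (by fun_prop) (Or.inl hz0)
  have hQc : ContinuousAt (symmetrizedDifference G u e l (n + α) x) y := by
    refine (hP y hyx.symm).add (ContinuousAt.comp (f := planeReflection e l) (hP _ ?_)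
      hR.continuousAt)
    intro hxy
    rw [hxy, planeReflection_involutive he] at hyx'
    exact hyx' rfl
  set m := -symmetrizedDifference G u e l (n + α) x y / 2 with hm
  have hm0 : 0 < m := by linarith
  obtain ⟨ρ, hρ, hball⟩ := Metric.eventually_nhds_iff_ball.1
    (hQc.eventually_lt_const (u := -m) (by linarith))
  set r := min ρ (min (dist y x / 2) (dist y (planeReflection e l x) / 2)) with hr
  have hr0 : 0 < r :=
    lt_min hρ (lt_min (half_pos (dist_pos.2 hyx)) (half_pos (dist_pos.2 hyx')))
  have hr1 : r ≤ ρ := min_le_left _ _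
  have hr2 : r ≤ dist y x / 2 := (min_le_right _ _).trans (min_le_left _ _)
  have hr3 : r ≤ dist y (planeReflection e l x) / 2 := (min_le_right _ _).trans (min_le_right _ _)
  have key := sub_le_of_symmetrizedDifference_le hn he hC h h' (planeReflection_ne he hx)
    (symmetrizedDifference_nonpos he hκ hc₀.le hG hx hx0.le hmin) (y := y) (r := r)
    (m := m) hr0 (by linarith) (by linarith)
    (fun z hz => (hball z (Metric.ball_subset_ball hr1 hz)).le)
  have hvol : 0 < volume.real (Metric.ball y r) :=
    ENNReal.toReal_pos (Metric.measure_ball_pos _ _ hr0).ne' measure_ball_lt_top.ne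
  have := mul_pos (mul_pos hC hm0) hvol
  linarith

end

/-! ### The moving plane method. -/

section

variable {n : ℕ} {G g : ℝ → ℝ} {u : EuclideanSpace ℝ (Fin n) → ℝ}
  {e : EuclideanSpace ℝ (Fin n)} {α C c₀ γ q : ℝ}

/-- At a negative minimum of the reflection defect, neither `u` nor the distance to the hyperplane
can be small. This serves both as the decay-at-infinity and as the narrow-region principle. -/
theorem exists_pos_le_rpow_mul_rpow (hn : 1 ≤ n) (hα : 0 < α) (hC : 0 < C) (hc₀ : 0 < c₀)
    (hG : ∀ s t : ℝ, s ≤ t → c₀ * (t - s) ≤ G t - G s)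
    (hg : ∀ s : ℝ, 0 < s → DifferentiableAt ℝ g s) (hupos : ∀ x, 0 < u x)
    (hsol : ∀ x, HasFAlpha C α G u x (g (u x))) (hq : 0 < q)
    (hg' : ∀ s : ℝ, 0 < s → deriv g s ≤ s ^ q) :
    ∃ c : ℝ, 0 < c ∧ ∀ (e : EuclideanSpace ℝ (Fin n)) (l : ℝ) (x : EuclideanSpace ℝ (Fin n)),
      ‖e‖ = 1 → inner ℝ e x < l → reflectionDefect u e l x < 0 →
      (∀ z, inner ℝ e z < l → reflectionDefect u e l x ≤ reflectionDefect u e l z) →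
      c ≤ u x ^ q * (l - inner ℝ e x) ^ α := by
  have hball : 0 < volume.real (Metric.ball (0 : EuclideanSpace ℝ (Fin n)) 1) :=
    ENNReal.toReal_pos (Metric.measure_ball_pos _ _ one_pos).ne' measure_ball_lt_top.ne
  refine ⟨C * c₀ * volume.real (Metric.ball (0 : EuclideanSpace ℝ (Fin n)) 1)
      * ((5 : ℝ) ^ ((n : ℝ) + α))⁻¹, by positivity, fun e l x he hx hneg hmin => ?_⟩
  have key := sub_le_reflectionDefect hn he hα hC hc₀.le hG (hsol x)
    (hsol (planeReflection e l x)) hx hneg.le hmin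
  set K := C * c₀ * volume.real (Metric.ball (0 : EuclideanSpace ℝ (Fin n)) 1)
      * ((5 : ℝ) ^ ((n : ℝ) + α))⁻¹
  have hd : 0 < (l - inner ℝ e x) ^ α := Real.rpow_pos_of_pos (sub_pos.2 hx) _
  have ha := hupos (planeReflection e l x)
  have hb := hupos x
  have hab : u (planeReflection e l x) < u x := sub_neg.1 hneg
  have hdiff : ∀ s ∈ Set.Icc (u (planeReflection e l x)) (u x), DifferentiableAt ℝ g s :=
    fun s hs => hg s (ha.trans_le hs.1)
  obtain ⟨ξ, hξ, hslope⟩ := exists_deriv_eq_slope g hab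
    (fun s hs => (hdiff s hs).continuousAt.continuousWithinAt)
    (fun s hs => (hdiff s (Set.Ioo_subset_Icc_self hs)).differentiableWithinAt)
  have hbound : (g (u x) - g (u (planeReflection e l x))) / (u x - u (planeReflection e l x))
      ≤ u x ^ q := by
    rw [← hslope]
    exact (hg' ξ (ha.trans hξ.1)).trans (Real.rpow_le_rpow (ha.trans hξ.1).le hξ.2.le hq.le)
  rw [div_le_iff₀ (sub_pos.2 hab)] at hbound
  have hmul : K * ((l - inner ℝ e x) ^ α)⁻¹ * (u x - u (planeReflection e l x))
      ≤ u x ^ q * (u x - u (planeReflection e l x)) := by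
    simp only [reflectionDefect] at key
    linarith
  have := le_of_mul_le_mul_right hmul (sub_pos.2 hab)
  rwa [← div_eq_mul_inv, div_le_iff₀ hd] at this

theorem exists_rpow_mul_rpow_lt (hα : 0 < α) (hupos : ∀ x, 0 < u x)
    (hdecay : u =o[cocompact (EuclideanSpace ℝ (Fin n))] (fun x => ‖x‖ ^ (-γ)))
    (hq : 0 < q) (hqγ : α ≤ q * γ) {c L : ℝ} (hc : 0 < c) (hL : 0 ≤ L) :
    ∃ R : ℝ, ∀ x, R < ‖x‖ → u x ^ q * (L + ‖x‖) ^ α < c := by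
  -- Chosen so that `η ^ q * 2 ^ α = c / 2`; the `2 ^ α` comes from `L + ‖x‖ ≤ 2 * ‖x‖`.
  set η : ℝ := (c / (2 * 2 ^ α)) ^ q⁻¹ with hη
  have hη0 : 0 < η := by positivity
  have hηq : η ^ q = c / (2 * 2 ^ α) := Real.rpow_inv_rpow (by positivity) hq.ne'
  have hev := hdecay.def hη0
  rw [← Metric.cobounded_eq_cocompact, hasBasis_cobounded_norm.eventually_iff] at hev
  obtain ⟨R, -, hR⟩ := hev
  refine ⟨max R (max 1 L), fun x hx => ?_⟩
  have hxR : R ≤ ‖x‖ := ((le_max_left _ _).trans_lt hx).le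
  have hx1 : 1 ≤ ‖x‖ := (((le_max_left _ _).trans (le_max_right _ _)).trans_lt hx).le
  have hxL : L ≤ ‖x‖ := (((le_max_right _ _).trans (le_max_right _ _)).trans_lt hx).le
  have hx0 : 0 < ‖x‖ := by linarith
  have hux := hR hxR
  rw [Real.norm_of_nonneg (hupos x).le, Real.norm_of_nonneg (by positivity)] at hux
  have h1 : u x ^ q ≤ η ^ q * ‖x‖ ^ (-γ * q) := by
    rw [Real.rpow_mul hx0.le, ← Real.mul_rpow hη0.le (by positivity)]
    exact Real.rpow_le_rpow (hupos x).le hux hq.le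
  have h2 : (L + ‖x‖) ^ α ≤ 2 ^ α * ‖x‖ ^ α := by
    rw [← Real.mul_rpow (by norm_num) hx0.le]
    exact Real.rpow_le_rpow (by positivity) (by linarith) hα.le
  have h3 : ‖x‖ ^ (-γ * q) * ‖x‖ ^ α ≤ 1 := by
    rw [← Real.rpow_add hx0]
    exact Real.rpow_le_one_of_one_le_of_nonpos hx1 (by linarith)
  calc u x ^ q * (L + ‖x‖) ^ α
      ≤ (η ^ q * ‖x‖ ^ (-γ * q)) * (2 ^ α * ‖x‖ ^ α) := by gcongr
    _ = (η ^ q * 2 ^ α) * (‖x‖ ^ (-γ * q) * ‖x‖ ^ α) := by ring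
    _ ≤ (η ^ q * 2 ^ α) * 1 := by gcongr
    _ = c / 2 := by
      rw [hηq]
      field_simp
    _ < c := by linarith

theorem tendsto_cocompact_zero_of_isLittleO (hγ : 0 < γ)
    (hdecay : u =o[cocompact (EuclideanSpace ℝ (Fin n))] (fun x => ‖x‖ ^ (-γ))) :
    Tendsto u (cocompact _) (𝓝 0) :=
  hdecay.isBigO.trans_tendsto
    ((tendsto_rpow_neg_atTop hγ).comp (tendsto_norm_cocompact_atTop))

/-- The defect vanishes on the hyperplane and tends to zero at infinity, so a negative infimum is
attained in the open half-space. -/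
theorem exists_negative_minimum (he : ‖e‖ = 1) (hu : Continuous u)
    (hlim : Tendsto u (cocompact _) (𝓝 0)) {l : ℝ} {x : EuclideanSpace ℝ (Fin n)}
    (hx : inner ℝ e x < l) (hneg : reflectionDefect u e l x < 0) :
    ∃ y, inner ℝ e y < l ∧ reflectionDefect u e l y < 0 ∧
      ∀ z, inner ℝ e z < l → reflectionDefect u e l y ≤ reflectionDefect u e l z := by
  have hR := isometry_planeReflection (l := l) he
  have hcont : Continuous (reflectionDefect u e l) :=
    (hu.comp hR.continuous).sub hu
  have hW : Tendsto (reflectionDefect u e l) (cocompact _) (𝓝 0) := by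
    have := (hlim.comp hR.isClosedEmbedding.tendsto_cocompact).sub hlim
    rwa [sub_zero] at this
  obtain ⟨y, hy, hmin⟩ := hcont.continuousOn.exists_isMinOn'
    (s := {z | inner ℝ e z ≤ l}) (isClosed_le (by fun_prop) continuous_const) (x₀ := x) hx.le
    (((hW.eventually_const_lt hneg).mono fun _ h => h.le).filter_mono inf_le_left)
  have hyneg : reflectionDefect u e l y < 0 :=
    (hmin (show inner ℝ e x ≤ l from hx.le)).trans_lt hneg
  refine ⟨y, lt_of_le_of_ne hy fun h => ?_, hyneg,
    fun z hz => hmin (show inner ℝ e z ≤ l from hz.le)⟩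
  rw [reflectionDefect_of_inner_eq h] at hyneg
  exact lt_irrefl _ hyneg

/-- The moving plane method: `u` is symmetric across some hyperplane orthogonal to `e`. -/
theorem exists_reflectionDefect_eq_zero (hn : 1 ≤ n) (hα : 0 < α) (hC : 0 < C) (hc₀ : 0 < c₀)
    (hGc : Continuous G) (hG : ∀ s t : ℝ, s ≤ t → c₀ * (t - s) ≤ G t - G s)
    (hg : ∀ s : ℝ, 0 < s → DifferentiableAt ℝ g s) (hu : Continuous u) (hupos : ∀ x, 0 < u x)
    (hsol : ∀ x, HasFAlpha C α G u x (g (u x))) (hγ : 0 < γ)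
    (hdecay : u =o[cocompact (EuclideanSpace ℝ (Fin n))] (fun x => ‖x‖ ^ (-γ)))
    (hq : α ≤ q * γ) (hg' : ∀ s : ℝ, 0 < s → deriv g s ≤ s ^ q) (he : ‖e‖ = 1) :
    ∃ l : ℝ, ∀ x, u (planeReflection e l x) = u x := by
  have hq0 : 0 < q := pos_of_mul_pos_left (hα.trans_le hq) hγ.le
  have hlim := tendsto_cocompact_zero_of_isLittleO hγ hdecay
  have hWc := continuous_reflectionDefect hu e
  obtain ⟨c, hc, hmin⟩ := exists_pos_le_rpow_mul_rpow hn hα hC hc₀ hG hg hupos hsol hq0 hg'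
  -- Negative minima stay in one ball, uniformly over `l ≤ L`, because `l - ⟪e, x⟫ ≤ L + ‖x‖`.
  have hbounded : ∀ L : ℝ, 0 ≤ L → ∃ R : ℝ, ∀ l ≤ L, ∀ x, inner ℝ e x < l →
      reflectionDefect u e l x < 0 → (∀ z, inner ℝ e z < l →
        reflectionDefect u e l x ≤ reflectionDefect u e l z) → ‖x‖ ≤ R := by
    intro L hL
    obtain ⟨R, hR⟩ := exists_rpow_mul_rpow_lt hα hupos hdecay hq0 hq hc hL
    refine ⟨R, fun l hl x hx hneg hm => ?_⟩
    by_contra! hxR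
    have h1 := hmin e l x he hx hneg hm
    have h2 : l - inner ℝ e x ≤ L + ‖x‖ := by
      have := abs_real_inner_le_norm e x
      rw [he, one_mul, abs_le] at this
      linarith [this.1]
    have h3 := Real.rpow_le_rpow (sub_pos.2 hx).le h2 hα.le
    have h4 := mul_le_mul_of_nonneg_left h3 (Real.rpow_nonneg (hupos x).le q)
    linarith [hR x hxR]
  set S : Set ℝ := {l | ∀ m ≤ l, ∀ x, inner ℝ e x < m → 0 ≤ reflectionDefect u e m x} with hS
  -- For `m ≤ -R` the half-space below `m` misses the closed ball of radius `R`, which confines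
  -- negative minima.
  have hSne : S.Nonempty := by
    obtain ⟨R, hR⟩ := hbounded 0 le_rfl
    refine ⟨min 0 (-R), fun m hm x hx => ?_⟩
    by_contra! hneg
    obtain ⟨y, hy, hyneg, hymin⟩ := exists_negative_minimum he hu hlim hx hneg
    have h1 := hR m (hm.trans (min_le_left _ _)) y hy hyneg hymin
    have h2 := abs_real_inner_le_norm e y
    rw [he, one_mul, abs_le] at h2
    linarith [h2.1, hm.trans (min_le_right _ _)]
  -- Otherwise `u 0 ≤ u ((2 * l) • e)` for all `l > 0`, and the right side tends to zero.
  have hSbdd : BddAbove S := by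
    by_contra hnb
    have hle : ∀ l : ℝ, 0 < l → u 0 ≤ u ((2 * l) • e) := by
      intro l hl
      obtain ⟨m, hm, hlm⟩ := not_bddAbove_iff.1 hnb l
      have := hm l hlm.le 0 (by simpa using hl)
      simpa [reflectionDefect, planeReflection] using this
    have hto : Tendsto (fun l : ℝ => (2 * l) • e) atTop (cocompact _) := by
      rw [← Metric.cobounded_eq_cocompact, ← tendsto_norm_atTop_iff_cobounded]
      simp only [norm_smul, he, mul_one]
      exact tendsto_norm_atTop_atTop.comp (tendsto_id.const_mul_atTop two_pos)
    have := ge_of_tendsto (hlim.comp hto) ((eventually_gt_atTop 0).mono hle)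
    linarith [hupos 0]
  set l := sSup S with hl
  have hbelow : ∀ m < l, ∀ x, inner ℝ e x < m → 0 ≤ reflectionDefect u e m x := by
    intro m hm
    obtain ⟨s, hs, hms⟩ := exists_lt_of_lt_csSup hSne hm
    exact hs m hms.le
  have hnonneg : ∀ x, inner ℝ e x < l → 0 ≤ reflectionDefect u e l x := by
    intro x hx
    have hct : Tendsto (fun m => reflectionDefect u e m x) (𝓝[<] l)
        (𝓝 (reflectionDefect u e l x)) :=
      ((hWc.comp (continuous_id.prodMk continuous_const)).tendsto l).mono_left
        nhdsWithin_le_nhds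
    refine ge_of_tendsto hct ?_
    filter_upwards [self_mem_nhdsWithin, nhdsWithin_le_nhds (Ioi_mem_nhds hx)] with m hm hxm
    exact hbelow m hm x hxm
  -- If the defect were positive throughout, planes just above `l` would have negative minima in a
  -- fixed ball. The lower bound `c` survives at a limit point, keeping it off the hyperplane, where
  -- the defect would be nonpositive.
  have hex : ∃ x, inner ℝ e x < l ∧ reflectionDefect u e l x = 0 := by
    by_contra! hcon
    have hstep : ∀ k : ℕ, ∃ p : ℝ × EuclideanSpace ℝ (Fin n), l ≤ p.1 ∧
        p.1 ≤ l + 1 / ((k : ℝ) + 1) ∧ inner ℝ e p.2 < p.1 ∧ reflectionDefect u e p.1 p.2 < 0 ∧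
        ∀ z, inner ℝ e z < p.1 → reflectionDefect u e p.1 p.2 ≤ reflectionDefect u e p.1 z := by
      intro k
      have hk : 0 < 1 / ((k : ℝ) + 1) := by positivity
      have hnot : l + 1 / ((k : ℝ) + 1) ∉ S := fun h => by linarith [le_csSup hSbdd h]
      simp only [hS, Set.mem_ofPred_eq, not_forall, not_le] at hnot
      obtain ⟨m, hm, x, hx, hneg⟩ := hnot
      obtain ⟨y, hy⟩ := exists_negative_minimum he hu hlim hx hneg
      refine ⟨(m, y), ?_, hm, hy⟩
      by_contra! hml
      linarith [hbelow m hml x hx]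
    choose p hp1 hp2 hp3 hp4 hp5 using hstep
    have hp_le : ∀ k, (p k).1 ≤ |l| + 1 := by
      intro k
      have : 1 / ((k : ℝ) + 1) ≤ 1 := by
        rw [div_le_one (by positivity)]
        linarith [(Nat.cast_nonneg k : (0 : ℝ) ≤ k)]
      linarith [hp2 k, le_abs_self l]
    obtain ⟨R, hR⟩ := hbounded (|l| + 1) (by positivity)
    obtain ⟨x, -, φ, hφ, hxlim⟩ := tendsto_subseq_of_bounded
      (Metric.isBounded_closedBall (x := (0 : EuclideanSpace ℝ (Fin n))) (r := R))
      (x := fun k => (p k).2) fun k => by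
        rw [mem_closedBall_zero_iff]
        exact hR _ (hp_le k) _ (hp3 k) (hp4 k) (hp5 k)
    have hllim : Tendsto (fun k => (p k).1) atTop (𝓝 l) := by
      refine tendsto_of_tendsto_of_tendsto_of_le_of_le tendsto_const_nhds ?_ hp1 hp2
      simpa using tendsto_one_div_add_atTop_nhds_zero_nat.const_add l
    have hplim : Tendsto (fun k => p (φ k)) atTop (𝓝 (l, x)) :=
      (hllim.comp hφ.tendsto_atTop).prodMk_nhds hxlim
    have hWx : reflectionDefect u e l x ≤ 0 :=
      le_of_tendsto ((hWc.tendsto (l, x)).comp hplim)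
        (Eventually.of_forall fun k => (hp4 (φ k)).le)
    have hFc : Continuous fun p : ℝ × EuclideanSpace ℝ (Fin n) =>
        u p.2 ^ q * (p.1 - inner ℝ e p.2) ^ α := by
      refine Continuous.mul ?_ ?_
      · exact (hu.comp continuous_snd).rpow_const fun _ => Or.inr hq0.le
      · exact Continuous.rpow_const (by fun_prop) fun _ => Or.inr hα.le
    have hFx : c ≤ u x ^ q * (l - inner ℝ e x) ^ α :=
      ge_of_tendsto ((hFc.tendsto (l, x)).comp hplim)
        (Eventually.of_forall fun k =>
          hmin e _ _ he (hp3 (φ k)) (hp4 (φ k)) (hp5 (φ k)))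
    have hxle : inner ℝ e x ≤ l := by
      have hc : Continuous fun p : ℝ × EuclideanSpace ℝ (Fin n) => p.1 - inner ℝ e p.2 := by
        fun_prop
      exact sub_nonneg.1 (ge_of_tendsto ((hc.tendsto (l, x)).comp hplim)
        (Eventually.of_forall fun k => (sub_pos.2 (hp3 (φ k))).le))
    have hxlt : inner ℝ e x < l := by
      refine lt_of_le_of_ne hxle fun h => ?_
      rw [h, sub_self, Real.zero_rpow hα.ne', mul_zero] at hFx
      linarith
    exact hcon x hxlt (le_antisymm hWx (hnonneg x hxlt))
  obtain ⟨x, hx, hx0⟩ := hex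
  -- Since `u` agrees at `x` and its reflection, both right-hand sides of the equation are equal.
  have hsolx := hsol (planeReflection e l x)
  rw [sub_eq_zero.1 hx0] at hsolx
  have hzero : ∀ y, inner ℝ e y < l → reflectionDefect u e l y = 0 := fun y hy =>
    reflectionDefect_eq_zero_of_inner_lt hn he hα hC hc₀ hGc hu hG (hsol x) hsolx hx hx0
      hnonneg hy
  refine ⟨l, fun y => sub_eq_zero.1 (?_ : reflectionDefect u e l y = 0)⟩
  rcases lt_trichotomy (inner ℝ e y) l with hy | hy | hy
  · exact hzero y hy
  · exact reflectionDefect_of_inner_eq hy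
  · rw [← neg_eq_zero, ← reflectionDefect_planeReflection he]
    exact hzero _ (by rw [inner_planeReflection he]; linarith)

end

/-! ### From hyperplane symmetries to radial symmetry. -/

section

variable {n : ℕ} {u : EuclideanSpace ℝ (Fin n) → ℝ}

/-- Composing the reflections along the coordinate axes gives a point reflection. -/
theorem exists_central_symmetry (hsymm : ∀ e : EuclideanSpace ℝ (Fin n), ‖e‖ = 1 →
    ∃ l : ℝ, ∀ x, u (planeReflection e l x) = u x) :
    ∃ x₀, ∀ x, u ((2 : ℝ) • x₀ - x) = u x := by
  have hunit : ∀ i : Fin n, ‖(EuclideanSpace.single i 1 : EuclideanSpace ℝ (Fin n))‖ = 1 := by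
    simp
  choose l hl using fun i => hsymm _ (hunit i)
  have hinner : ∀ (i : Fin n) (x : EuclideanSpace ℝ (Fin n)),
      inner ℝ (EuclideanSpace.single i 1) x = x i := by
    intro i x
    simp [EuclideanSpace.inner_single_left]
  have key : ∀ (s : Finset (Fin n)) (x : EuclideanSpace ℝ (Fin n)),
      u (WithLp.toLp 2 fun i => if i ∈ s then 2 * l i - x i else x i) = u x := by
    intro s x
    induction s using Finset.induction_on with
    | empty => simp
    | insert i s hi ih =>
      rw [← ih, ← hl i]
      congr 1
      ext j
      rw [planeReflection, hinner]
      by_cases hj : j = i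
      · subst hj
        simp [hi]
        ring
      · simp [hj]
  refine ⟨WithLp.toLp 2 l, fun x => ?_⟩
  rw [← key Finset.univ x]
  congr 1
  ext j
  simp

theorem isRadialAbout_of_symmetric (hupos : ∀ x, 0 < u x)
    (hlim : Tendsto u (cocompact _) (𝓝 0))
    (hsymm : ∀ e : EuclideanSpace ℝ (Fin n), ‖e‖ = 1 →
      ∃ l : ℝ, ∀ x, u (planeReflection e l x) = u x) :
    ∃ x₀, IsRadialAbout u x₀ := by
  obtain ⟨x₀, hx₀⟩ := exists_central_symmetry hsymm
  have hthrough : ∀ e : EuclideanSpace ℝ (Fin n), ‖e‖ = 1 →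
      ∀ x, u (planeReflection e (inner ℝ e x₀) x) = u x := by
    intro e he
    obtain ⟨l, hl⟩ := hsymm e he
    suffices l = inner ℝ e x₀ by rwa [← this]
    by_contra hne
    set d := l - inner ℝ e x₀ with hd
    have hd0 : d ≠ 0 := sub_ne_zero.2 hne
    -- On the line through `x₀` along `e`, the point reflection followed by the hyperplane
    -- reflection is translation by `2 * d`. Periodicity with `d ≠ 0` contradicts decay and
    -- positivity.
    have hshift : ∀ t : ℝ, u (x₀ + (t + 2 * d) • e) = u (x₀ + t • e) := by
      intro t
      rw [← hx₀ (x₀ + t • e), ← hl ((2 : ℝ) • x₀ - (x₀ + t • e))]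
      congr 1
      have : inner ℝ e ((2 : ℝ) • x₀ - (x₀ + t • e)) = inner ℝ e x₀ - t := by
        rw [inner_sub_right, inner_add_right, inner_smul_right, inner_smul_right,
          real_inner_self_eq_norm_sq, he]
        ring
      rw [planeReflection, this, show l - (inner ℝ e x₀ - t) = d + t by rw [hd]; ring]
      module
    have horbit : ∀ k : ℕ, u (x₀ + ((k : ℝ) * (2 * d)) • e) = u x₀ := by
      intro k
      induction k with
      | zero => simp
      | succ k ih => rw [← ih, Nat.cast_succ, add_one_mul, hshift]
    have hto : Tendsto (fun k : ℕ => x₀ + ((k : ℝ) * (2 * d)) • e) atTop (cocompact _) := by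
      rw [← Metric.cobounded_eq_cocompact]
      refine (tendsto_const_add_cobounded x₀).comp ?_
      rw [← tendsto_norm_atTop_iff_cobounded]
      have hpos : 0 < ‖2 * d‖ := norm_pos_iff.2 (mul_ne_zero two_ne_zero hd0)
      refine (tendsto_natCast_atTop_atTop.atTop_mul_const hpos).congr fun k => ?_
      rw [norm_smul, he, mul_one, norm_mul (k : ℝ), Real.norm_natCast]
    have := tendsto_nhds_unique ((hlim.comp hto).congr horbit) tendsto_const_nhds
    exact (hupos x₀).ne this
  refine ⟨x₀, fun x y hxy => ?_⟩
  by_cases hne : x = y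
  · rw [hne]
  have hpos : ‖x - y‖ ≠ 0 := norm_ne_zero_iff.2 (sub_ne_zero.2 hne)
  have he : ‖(‖x - y‖⁻¹ : ℝ) • (x - y)‖ = 1 := by
    rw [norm_smul, norm_inv, norm_norm, inv_mul_cancel₀ hpos]
  -- As `x` and `y` are equidistant from `x₀`, the hyperplane through `x₀` normal to `x - y` is
  -- their perpendicular bisector, so its reflection sends `y` to `x`.
  rw [← hthrough _ he y]
  congr 1
  have hinner : 2 * inner ℝ (x - y) (x₀ - y) = ‖x - y‖ ^ 2 := by
    have h := norm_sub_sq_real (x - y) (x₀ - y)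
    rw [sub_sub_sub_cancel_right, hxy, norm_sub_rev y x₀] at h
    linarith
  rw [planeReflection, ← inner_sub_right, real_inner_smul_left, smul_smul,
    show 2 * (‖x - y‖⁻¹ * inner ℝ (x - y) (x₀ - y)) * ‖x - y‖⁻¹
      = (2 * inner ℝ (x - y) (x₀ - y)) * (‖x - y‖⁻¹ * ‖x - y‖⁻¹) by ring, hinner]
  field_simp
  simp

end

end FullyNonlinear

theorem theorem3p2
    (n : ℕ) (hn : 1 ≤ n)
    (α : ℝ) (hα0 : 0 < α) (hα2 : α < 2)
    (C : ℝ) (hC : 0 < C)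
    (G : ℝ → ℝ) (hG : ContDiff ℝ 1 G) (hG0 : G 0 = 0)
    (c₀ : ℝ) (hc₀ : 0 < c₀) (hG' : ∀ t : ℝ, c₀ ≤ deriv G t)
    (g : ℝ → ℝ) (hg : ∀ s : ℝ, 0 < s → DifferentiableAt ℝ g s)
    (u : EuclideanSpace ℝ (Fin n) → ℝ)
    (hu : FullyNonlinear.IsC11Loc u) (huL : FullyNonlinear.MemLAlpha α u)
    (hupos : ∀ x, 0 < u x)
    (hsol : ∀ x, FullyNonlinear.HasFAlpha C α G u x (g (u x)))
    (γ : ℝ) (hγ : 0 < γ)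
    (hdecay : u =o[cocompact (EuclideanSpace ℝ (Fin n))] (fun x => ‖x‖ ^ (-γ)))
    (q : ℝ) (hq : α ≤ q * γ)
    (hg' : ∀ s : ℝ, 0 < s → deriv g s ≤ s ^ q) :
    ∃ x₀ : EuclideanSpace ℝ (Fin n), FullyNonlinear.IsRadialAbout u x₀ := by
  have hGmono : ∀ s t : ℝ, s ≤ t → c₀ * (t - s) ≤ G t - G s :=
    fun s t hst => mul_sub_le_image_sub_of_le_deriv (hG.differentiable one_ne_zero) hG' hst
  exact FullyNonlinear.isRadialAbout_of_symmetric hupos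
    (FullyNonlinear.tendsto_cocompact_zero_of_isLittleO hγ hdecay) fun e he =>
      FullyNonlinear.exists_reflectionDefect_eq_zero hn hα0 hC hc₀ hG.continuous hGmono hg
        hu.1.continuous hupos hsol hγ hdecay hq hg' he
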